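/- A Fractran program $P$ is a finite list of positive fractions $\frac{p_1}{q_1},\ldots,\frac{p_k}{q_k}$. Its one-step computation is the partial function $f_P : \mathbb{N} \rightharpoonup \mathbb{N}$ given by $f_P(n) = n\cdot\frac{p_i}{q_i}$, where $\frac{p_i}{q_i}$ is the first fraction of $P$ such that $n\cdot\frac{p_i}{q_i}\in\mathbb{N}$, and $f_P(n)$ is undefined if there is no such fraction. The program $P$ halts on $n$ if there is an $i \in \mathbb{N}$ such that $f_P^{\,i}(n)$ is undefined. Theorem. The uniform halting problem for Fractran programs, that is, the problem of deciding whether a given Fractran program $P$ halts on every positive integer $n_0 \ge 1$, is $\Pi^0_2$-complete. That is: 1. there is a decidable relation $R$ such that, for every Fractran program $P$, $P$ halts on all positive integers if and only if $\forall x \in \mathbb{N}\; \exists y \in \mathbb{N}\; R(P,x,y)$; and 2. every $\Pi^0_2$ set $A \subseteq \mathbb{N}$ (i.e. every set of the form $A=\{a : \forall x\, \exists y\, S(a,x,y)\}$ with $S \subseteq \mathbb{N}^3$ decidable) is many-one reducible to it: there is a total computable map $a \mapsto P_a$ from $\mathbb{N}$ to Fractran programs such that $a \in A$ if and only if $P_a$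 halts on all positive integers. -/

import Mathlib

/-- A predicate `p` is `Π⁰₂` if there is a decidable (recursive) relation `R` such that
`p a ↔ ∀ x, ∃ y, R a x y` for all `a`, with `x` and `y` ranging over the natural numbers. -/
def IsPi02 {α : Type*} [Primcodable α] (p : α → Prop) : Prop :=
  ∃ R : α → ℕ → ℕ → Prop,
    ComputablePred (fun t : α × ℕ × ℕ => R t.1 t.2.1 t.2.2) ∧
      ∀ a, p a ↔ ∀ x, ∃ y, R a x y

/-- A predicate `p` is `Π⁰₂`-hard if every `Π⁰₂` set of natural numbers is many-one reducible
to `p` by a total computable function. -/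
def IsPi02Hard {α : Type*} [Primcodable α] (p : α → Prop) : Prop :=
  ∀ q : ℕ → Prop, IsPi02 q → ManyOneReducible q p

/-- A predicate is `Π⁰₂`-complete if it is `Π⁰₂` and `Π⁰₂`-hard. -/
def IsPi02Complete {α : Type*} [Primcodable α] (p : α → Prop) : Prop :=
  IsPi02 p ∧ IsPi02Hard p

namespace Fractran

/-- A positive fraction, given as (numerator, denominator); it need not be in lowest terms. -/
abbrev Fraction : Type := ℕ+ × ℕ+

/-- A Fractran program is a finite list of positive fractions. -/
abbrev Program : Type := List Fraction

/-- The one step computation of a program, a partial function on the natural numbers: multiply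
`n` by the first fraction `a / b` of the program such that `n * (a / b)` is an integer, that is,
such that `b ∣ n * a`. The value is `none` (undefined) if there is no such fraction. -/
def step : Program → ℕ → Option ℕ
  | [], _ => none
  | (a, b) :: P, n => if (b : ℕ) ∣ n * (a : ℕ) then some (n * (a : ℕ) / (b : ℕ)) else step P n

/-- The `i`-th iterate of the partial function `step P`, applied to `n`. -/
def iter (P : Program) (n : ℕ) : ℕ → Option ℕ
  | 0 => some n
  | i + 1 => (iter P n i).bind (step P)

/-- `P` halts on `n` if some iterate of `step P` is undefined at `n`. -/
def Halts (P : Program) (n : ℕ) : Prop :=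
  ∃ i : ℕ, iter P n i = none

/-- The uniform halting problem: `P` halts on every positive integer. -/
def UniformlyHalts (P : Program) : Prop :=
  ∀ n : ℕ, 0 < n → Halts P n

end Fractran

/-! Upper bound: iterating `step` is primitive recursive, so "`P` stops on `x + 1` within `y` steps"
is a decidable matrix.

Hardness: a `Π⁰₂` set has the form `∀ x, ∃ t, f a x t = 0` with `f` primitive recursive and the zero
persistent in `t` (`IsPi02.exists_primrec'`). A bounded loop program computes `f`
(`LoopProgram.exists_computes`); wrapped in one while loop that increments `t` until `f` vanishes,
it becomes a counter machine, which a Fractran program simulates with one prime per program position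
and one per register.

The difficulty is that halting is required on every positive integer, hence from every
configuration, including meaningless ones. Four points deal with this. Scratch registers need not
start at zero, and `a` is rewritten on each pass. All loops inside the body are bounded, so
execution started anywhere inside it returns to the head of the while loop (`exists_reaches_end`).
An arbitrary initial `t` is harmless because the zero persists (`forall_terminates_search`).
Integers with several program counters are reduced by `cleanup` fractions, which strictly decrease
the number, until it represents one configuration, possibly a halted one (`exists_represents`,
`lt_of_step_cleanup`).

Conversely, for each `x` the integer encoding the initial configuration with input `x` halts only if
some `t` works. The reduction is computable because `a` enters only as an exponent in one numerator.
-/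

/-! ### Primitive recursiveness of Fractran computation and the upper bound -/

theorem Primrec.pnat_val : Primrec (fun p : ℕ+ => (p : ℕ)) :=
  (Primrec.succ.comp (Primrec.encode (α := ℕ+))).of_eq fun p => PNat.natPred_add_one p

theorem Primrec.succPNat : Primrec Nat.succPNat :=
  (Primrec.ofNat ℕ+).of_eq fun _ => rfl

theorem Primrec.nat_pow_left (b : ℕ) : Primrec (fun n : ℕ => b ^ n) := by
  refine (Primrec.nat_rec₁ (f := fun _ m => m * b) 1
    (Primrec.nat_mul.comp Primrec.snd (Primrec.const b)).to₂).of_eq fun n => ?_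
  induction n with
  | zero => rfl
  | succ n ih => rw [pow_succ, ← ih]

theorem PrimrecRel.nat_dvd : PrimrecRel (fun a b : ℕ => a ∣ b) := by
  refine (PrimrecRel.comp Primrec.eq (Primrec.nat_mod.comp Primrec.snd Primrec.fst)
    (Primrec.const 0)).of_eq fun p => ?_
  exact (Nat.dvd_iff_mod_eq_zero ..).symm

namespace Fractran

theorem step_eq_foldr (P : Program) (n : ℕ) :
    step P n = P.foldr (fun f s => if (f.2 : ℕ) ∣ n * (f.1 : ℕ)
      then some (n * (f.1 : ℕ) / (f.2 : ℕ)) else s) none := by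
  induction P with
  | nil => rfl
  | cons f P ih => rw [List.foldr_cons, ← ih]; rfl

theorem primrec_step : Primrec₂ step := by
  have hnum : Primrec (fun t : (Program × ℕ) × Fraction × Option ℕ => t.1.2 * (t.2.1.1 : ℕ)) :=
    Primrec.nat_mul.comp (Primrec.snd.comp Primrec.fst)
      (Primrec.pnat_val.comp (Primrec.fst.comp (Primrec.fst.comp Primrec.snd)))
  have hden : Primrec (fun t : (Program × ℕ) × Fraction × Option ℕ => (t.2.1.2 : ℕ)) :=
    Primrec.pnat_val.comp (Primrec.snd.comp (Primrec.fst.comp Primrec.snd))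
  have h : Primrec (fun t : (Program × ℕ) × Fraction × Option ℕ =>
      if (t.2.1.2 : ℕ) ∣ t.1.2 * (t.2.1.1 : ℕ)
      then some (t.1.2 * (t.2.1.1 : ℕ) / (t.2.1.2 : ℕ)) else t.2.2) :=
    Primrec.ite (PrimrecRel.comp PrimrecRel.nat_dvd hden hnum)
      (Primrec.option_some.comp (Primrec.nat_div.comp hnum hden))
      (Primrec.snd.comp Primrec.snd)
  exact (Primrec.list_foldr Primrec.fst (Primrec.const none) h.to₂).of_eq
    fun t => (step_eq_foldr t.1 t.2).symm

theorem primrec_iter : Primrec₂ (fun (a : Program × ℕ) (i : ℕ) => iter a.1 a.2 i) := by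
  have h : Primrec₂ (fun (a : Program × ℕ) (t : ℕ × Option ℕ) => t.2.bind (step a.1)) :=
    Primrec.option_bind (Primrec.snd.comp Primrec.snd)
      (primrec_step.comp (Primrec.fst.comp (Primrec.fst.comp Primrec.fst)) Primrec.snd).to₂
  refine (Primrec.nat_rec (f := fun a : Program × ℕ => some a.2)
    (Primrec.option_some.comp Primrec.snd) h).of_eq fun t i => ?_
  induction i with
  | zero => rfl
  | succ i ih => exact congrArg (fun o => Option.bind o (step t.1)) ih

theorem isPi02_uniformlyHalts : IsPi02 UniformlyHalts := by
  -- The shift `x + 1` makes the universal quantifier range over exactly the positive integers.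
  refine ⟨fun P x y => iter P (x + 1) y = none, ⟨inferInstance, ?_⟩, fun P => ?_⟩
  · have h : Primrec (fun t : Program × ℕ × ℕ => iter t.1 (t.2.1 + 1) t.2.2) :=
      primrec_iter.comp (Primrec.fst.pair
        (Primrec.succ.comp (Primrec.fst.comp Primrec.snd))) (Primrec.snd.comp Primrec.snd)
    exact (PrimrecPred.decide (PrimrecRel.comp Primrec.eq h (Primrec.const none))).to_comp
  · exact ⟨fun h x => h _ x.succ_pos, fun h n hn => by
      obtain ⟨m, rfl⟩ := Nat.exists_eq_add_one_of_ne_zero hn.ne'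
      exact h m⟩

end Fractran

/-! ### A monotone normal form for `Π⁰₂` sets -/

open Nat.Partrec (Code) in
/-- A `Π⁰₂` set has a primitive recursive bounded search for its inner quantifier: the value `0`
signals success, and is kept by all larger bounds. -/
theorem IsPi02.exists_primrec' {q : ℕ → Prop} (hq : IsPi02 q) :
    ∃ f : List.Vector ℕ 3 → ℕ, Nat.Primrec' f ∧
      (∀ a x t t', t ≤ t' → f (a ::ᵥ x ::ᵥ t ::ᵥ .nil) = 0 → f (a ::ᵥ x ::ᵥ t' ::ᵥ .nil) = 0) ∧
      ∀ a, q a ↔ ∀ x, ∃ t, f (a ::ᵥ x ::ᵥ t ::ᵥ .nil) = 0 := by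
  obtain ⟨R, hR, hqR⟩ := hq
  obtain ⟨b, hb, hRb⟩ := ComputablePred.computable_iff.1 hR
  have hRb (a x y : ℕ) : R a x y ↔ b (a, x, y) = true := iff_of_eq (congrFun hRb (a, x, y))
  have hsearch : Partrec (fun n : ℕ => Nat.rfind fun y =>
      Part.some (b (n.unpair.1, n.unpair.2, y))) := by
    have hn : Primrec (fun p : ℕ × ℕ => p.1.unpair) := Primrec.unpair.comp Primrec.fst
    have h : Computable₂ (fun n y : ℕ => b (n.unpair.1, n.unpair.2, y)) :=
      hb.comp ((Primrec.fst.comp hn).pair ((Primrec.snd.comp hn).pair Primrec.snd)).to_comp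
    exact Partrec.rfind h.partrec₂
  -- The existential becomes halting of the unbounded search coded by `c`. Its fuel-bounded version
  -- `evaln` is primitive recursive and monotone in the fuel, so the fuel serves as the new inner
  -- variable.
  obtain ⟨c, hc⟩ := Code.exists_code.1 (Partrec.nat_iff.1 hsearch)
  have hdom : ∀ a x, (∃ y, R a x y) ↔ ∃ t, (Code.evaln t c (Nat.pair a x)).isSome := by
    intro a x
    have h1 : (∃ y, R a x y) ↔ (Code.eval c (Nat.pair a x)).Dom := by
      rw [hc]
      refine ⟨fun ⟨y, hy⟩ => Nat.rfind_dom.2 ⟨y, ?_, fun _ => trivial⟩, fun h => ?_⟩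
      · simpa only [Nat.unpair_pair] using Part.mem_some_iff.2 ((hRb a x y).1 hy).symm
      · obtain ⟨y, hy, -⟩ := Nat.rfind_dom.1 h
        exact ⟨y, (hRb a x y).2 (by
          simpa only [Nat.unpair_pair] using (Part.mem_some_iff.1 hy).symm)⟩
    rw [h1, Part.dom_iff_mem]
    simp only [Code.evaln_complete, Option.isSome_iff_exists, Option.mem_def]
    exact exists_comm
  refine ⟨fun v => bif (Code.evaln (v.get 2) c (Nat.pair (v.get 0) (v.get 1))).isSome
    then 0 else 1, Nat.Primrec'.of_prim ?_, ?_, fun a => ?_⟩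
  · have hget (i : Fin 3) : Primrec (fun v : List.Vector ℕ 3 => v.get i) :=
      Primrec.vector_get.comp Primrec.id (Primrec.const i)
    have h : Primrec (fun v : List.Vector ℕ 3 =>
        Code.evaln (v.get 2) c (Nat.pair (v.get 0) (v.get 1))) :=
      Code.primrec_evaln.comp (((hget 2).pair (Primrec.const c)).pair
        (Primrec₂.natPair.comp (hget 0) (hget 1)))
    exact Primrec.cond (Primrec.option_isSome.comp h) (Primrec.const 0) (Primrec.const 1)
  · intro a x t t' htt h
    change (bif (Code.evaln t c (Nat.pair a x)).isSome then 0 else 1) = 0 at h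
    change (bif (Code.evaln t' c (Nat.pair a x)).isSome then 0 else 1) = 0
    have ht : (Code.evaln t c (Nat.pair a x)).isSome = true := by
      by_contra hne
      rw [Bool.not_eq_true] at hne
      rw [hne] at h
      exact one_ne_zero h
    obtain ⟨z, hz⟩ := Option.isSome_iff_exists.1 ht
    have := Code.evaln_mono htt hz
    rw [Option.mem_def] at this
    rw [this]; rfl
  · rw [hqR]
    refine forall_congr' fun x => (hdom a x).trans (exists_congr fun t => ?_)
    change _ ↔ (bif (Code.evaln t c (Nat.pair a x)).isSome then 0 else 1) = 0
    cases (Code.evaln t c (Nat.pair a x)).isSome <;> simp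

/-! ### Bounded loop programs compute the primitive recursive functions -/

/-- Loop programs over registers indexed by natural numbers. In `loop r p` the register `r` is
decreased before each run of the body `p`, until it is zero. -/
inductive LoopProgram : Type
  | skip : LoopProgram
  | add (r m : ℕ) : LoopProgram
  | seq (p q : LoopProgram) : LoopProgram
  | loop (r : ℕ) (p : LoopProgram) : LoopProgram

namespace LoopProgram

open Function (update)

/-- The registers mentioned by a program. -/
def vars : LoopProgram → Set ℕ
  | skip => ∅
  | add r _ => {r}
  | seq p q => p.vars ∪ q.vars
  | loop r p => insert r p.vars

/-- A program is bounded if no loop body mentions the register which controls the loop. -/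
def Bounded : LoopProgram → Prop
  | skip => True
  | add _ _ => True
  | seq p q => p.Bounded ∧ q.Bounded
  | loop r p => r ∉ p.vars ∧ p.Bounded

/-- The effect of a bounded program on the registers. -/
def exec : LoopProgram → (ℕ → ℕ) → ℕ → ℕ
  | skip, s => s
  | add r m, s => update s r (s r + m)
  | seq p q, s => q.exec (p.exec s)
  | loop r p, s => (fun s => p.exec (update s r (s r - 1)))^[s r] s

theorem exec_of_notMem_vars {r : ℕ} : ∀ {p : LoopProgram} (s : ℕ → ℕ), r ∉ p.vars →
    p.exec s r = s r
  | skip, _, _ => rfl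
  | add _ _, _, h => Function.update_of_ne h _ _
  | seq p q, s, h => by
    rw [vars, Set.mem_union, not_or] at h
    rw [exec, exec_of_notMem_vars _ h.2, exec_of_notMem_vars _ h.1]
  | loop c p, s, h => by
    rw [vars, Set.mem_insert_iff, not_or] at h
    rw [exec]
    generalize s c = n
    induction n generalizing s with
    | zero => rfl
    | succ n ih =>
      rw [Function.iterate_succ_apply, ih, exec_of_notMem_vars _ h.2, Function.update_of_ne h.1]

theorem exec_loop_of_eq_zero {r : ℕ} {p : LoopProgram} {s : ℕ → ℕ} (h : s r = 0) :
    (loop r p).exec s = s := by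
  rw [exec, h]; rfl

/-- `exec` fixes the number of rounds on entry, whereas a machine rereads `r` each round. The two
agree because the body does not touch `r`. -/
theorem exec_loop_of_eq_succ {r n : ℕ} {p : LoopProgram} {s : ℕ → ℕ} (hr : r ∉ p.vars)
    (h : s r = n + 1) : (loop r p).exec s = (loop r p).exec (p.exec (update s r n)) := by
  rw [exec, h, Function.iterate_succ_apply, exec, h, Nat.add_sub_cancel,
    exec_of_notMem_vars _ hr, Function.update_self]

/-- The invariant rule for loops. -/
theorem exec_loop_induction {r : ℕ} {p : LoopProgram} (hr : r ∉ p.vars) {I : (ℕ → ℕ) → Prop}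
    (hI : ∀ s n, s r = n + 1 → I s → I (p.exec (update s r n))) {s : ℕ → ℕ} (hs : I s) :
    I ((loop r p).exec s) ∧ (loop r p).exec s r = 0 := by
  induction h : s r generalizing s with
  | zero => rw [exec_loop_of_eq_zero h]; exact ⟨hs, h⟩
  | succ n ih =>
    rw [exec_loop_of_eq_succ hr h]
    refine ih (hI s n h hs) ?_
    rw [exec_of_notMem_vars _ hr, Function.update_self]

/-- Set a register to zero. -/
def clear (r : ℕ) : LoopProgram := loop r skip

theorem bounded_clear (r : ℕ) : (clear r).Bounded := ⟨id, trivial⟩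

theorem mem_vars_clear {r i : ℕ} : i ∈ (clear r).vars ↔ i = r := by
  simp [clear, vars]

theorem exec_clear (r : ℕ) (s : ℕ → ℕ) : (clear r).exec s = update s r 0 := by
  funext i
  by_cases hi : i = r
  · subst hi
    rw [Function.update_self]
    exact (exec_loop_induction (I := fun _ => True) id (fun _ _ _ _ => trivial) trivial).2
  · rw [Function.update_of_ne hi, exec_of_notMem_vars _ (mt mem_vars_clear.1 hi)]

/-- Move the contents of register `a` to register `b`. -/
def move (a b : ℕ) : LoopProgram := seq (clear b) (loop a (add b 1))

theorem bounded_move {a b : ℕ} (h : a ≠ b) : (move a b).Bounded :=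
  ⟨bounded_clear b, h, trivial⟩

theorem mem_vars_move {a b i : ℕ} : i ∈ (move a b).vars ↔ i = a ∨ i = b := by
  simp only [move, vars, Set.mem_union, mem_vars_clear, Set.mem_insert_iff, Set.mem_singleton_iff]
  tauto

theorem exec_move {a b : ℕ} (h : a ≠ b) (s : ℕ → ℕ) :
    (move a b).exec s = update (update s b (s a)) a 0 := by
  have key := exec_loop_induction (r := a) (p := add b 1) h
    (I := fun t => t b + t a = s a ∧ ∀ i, i ≠ a → i ≠ b → t i = s i)
    (fun t n hn ⟨h1, h2⟩ => by
      refine ⟨?_, fun i hia hib => ?_⟩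
      · simp only [exec, Function.update_self, Function.update_of_ne h, Function.update_of_ne h.symm]
        omega
      · simp only [exec, Function.update_of_ne hia, Function.update_of_ne hib, h2 i hia hib])
    (s := update s b 0) (by
      refine ⟨?_, fun i _ hib => Function.update_of_ne hib _ _⟩
      rw [Function.update_self, Function.update_of_ne h, zero_add])
  rw [move, exec, exec_clear]
  obtain ⟨⟨h1, h2⟩, h3⟩ := key
  funext i
  by_cases hia : i = a
  · subst hia
    rw [Function.update_self, h3]
  · rw [Function.update_of_ne hia]
    by_cases hib : i = b
    · subst hib
      rw [Function.update_self, ← h1, h3, add_zero]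
    · rw [Function.update_of_ne hib, h2 i hia hib]

/-- Copy the contents of register `a` to register `b`, with the help of register `c`. -/
def copy (a b c : ℕ) : LoopProgram :=
  seq (clear b) (seq (clear c) (seq (loop a (seq (add b 1) (add c 1))) (move c a)))

theorem bounded_copy {a b c : ℕ} (hab : a ≠ b) (hac : a ≠ c) : (copy a b c).Bounded :=
  ⟨bounded_clear b, bounded_clear c, ⟨fun h => h.elim hab hac, trivial, trivial⟩,
    bounded_move hac.symm⟩

theorem mem_vars_copy {a b c i : ℕ} : i ∈ (copy a b c).vars ↔ i = a ∨ i = b ∨ i = c := by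
  simp only [copy, vars, Set.mem_union, mem_vars_clear, mem_vars_move, Set.mem_insert_iff,
    Set.mem_singleton_iff]
  tauto

theorem exec_copy {a b c : ℕ} (hab : a ≠ b) (hac : a ≠ c) (hbc : b ≠ c) (s : ℕ → ℕ) :
    (copy a b c).exec s = update (update s b (s a)) c 0 := by
  have key := exec_loop_induction (r := a) (p := seq (add b 1) (add c 1))
    (fun h => h.elim hab hac)
    (I := fun t => t b + t a = s a ∧ t c + t a = s a ∧ ∀ i, i ≠ a → i ≠ b → i ≠ c → t i = s i)
    (fun t n hn ⟨h1, h2, h3⟩ => by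
      refine ⟨?_, ?_, fun i hia hib hic => ?_⟩
      · simp only [exec, Function.update_self, Function.update_of_ne hab,
          Function.update_of_ne hac, Function.update_of_ne hbc, Function.update_of_ne hab.symm]
        omega
      · simp only [exec, Function.update_self, Function.update_of_ne hab,
          Function.update_of_ne hac, Function.update_of_ne hbc.symm,
          Function.update_of_ne hac.symm]
        omega
      · simp only [exec, Function.update_of_ne hia, Function.update_of_ne hib,
          Function.update_of_ne hic, h3 i hia hib hic])
    (s := update (update s b 0) c 0) (by
      refine ⟨?_, ?_, fun i _ hib hic => ?_⟩
      · rw [Function.update_of_ne hbc, Function.update_self, Function.update_of_ne hac,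
          Function.update_of_ne hab, zero_add]
      · rw [Function.update_self, Function.update_of_ne hac, Function.update_of_ne hab, zero_add]
      · rw [Function.update_of_ne hic, Function.update_of_ne hib])
  rw [copy, exec, exec_clear, exec, exec_clear, exec, exec_move hac.symm]
  obtain ⟨⟨h1, h2, h3⟩, h4⟩ := key
  rw [h4, add_zero] at h1 h2
  funext i
  by_cases hic : i = c
  · subst hic
    rw [Function.update_self, Function.update_self]
  rw [Function.update_of_ne hic, Function.update_of_ne hic]
  by_cases hia : i = a
  · subst hia
    rw [Function.update_self, Function.update_of_ne hab, h2]
  rw [Function.update_of_ne hia]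
  by_cases hib : i = b
  · subst hib
    rw [Function.update_self, h1]
  · rw [Function.update_of_ne hib, h3 i hia hib hic]

/-- `p.Computes f ins k` says that the bounded program `p` reads the arguments of `f` from the
registers `ins`, writes the value of `f` to register `k`, and keeps all registers below `k`;
its scratch registers are all above `k` and need not be clear. -/
structure Computes (p : LoopProgram) {n : ℕ} (f : List.Vector ℕ n → ℕ) (ins : Fin n → ℕ)
    (k : ℕ) : Prop where
  bounded : p.Bounded
  vars_subset : ∀ r ∈ p.vars, k ≤ r ∨ ∃ i, r = ins i
  exec_self : ∀ s, p.exec s k = f (List.Vector.ofFn fun i => s (ins i))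
  exec_of_lt : ∀ s, ∀ r < k, p.exec s r = s r

theorem Computes.intro {p : LoopProgram} {n : ℕ} {f : List.Vector ℕ n → ℕ} {ins : Fin n → ℕ}
    {k : ℕ} (hp : p.Bounded) (hv : ∀ r ∈ p.vars, k ≤ r ∨ ∃ i, r = ins i)
    (h : ∀ s, p.exec s k = f (List.Vector.ofFn fun i => s (ins i)) ∧ ∀ r < k, p.exec s r = s r) :
    p.Computes f ins k :=
  ⟨hp, hv, fun s => (h s).1, fun s => (h s).2⟩

/-- The results go to consecutive registers in increasing order: the program with output register `k
+ i` may spoil only registers from `k + i` on, so the inputs and the earlier results survive. -/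
theorem exists_computes_family {m n : ℕ} {g : Fin n → List.Vector ℕ m → ℕ} {ins : Fin m → ℕ}
    {k : ℕ} (hins : ∀ i, ins i < k)
    (hg : ∀ i l, (∀ j, ins j < l) → ∃ p : LoopProgram, p.Computes (g i) ins l) :
    ∀ l ≤ n, ∃ p : LoopProgram, p.Bounded ∧ (∀ r ∈ p.vars, k ≤ r ∨ ∃ i, r = ins i) ∧
      ∀ s, (∀ i : Fin n, i.1 < l → p.exec s (k + i) = g i (List.Vector.ofFn fun j => s (ins j))) ∧
        ∀ r < k, p.exec s r = s r := by
  intro l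
  induction l with
  | zero =>
    exact fun _ => ⟨skip, trivial, fun r h => h.elim,
      fun s => ⟨fun i h => absurd h i.1.not_lt_zero, fun _ _ => rfl⟩⟩
  | succ l ih =>
    intro hl
    obtain ⟨p, hp, hpv, hps⟩ := ih (by omega)
    obtain ⟨q, hq⟩ := hg ⟨l, hl⟩ (k + l) fun j => (hins j).trans_le (Nat.le_add_right _ _)
    refine ⟨seq p q, ⟨hp, hq.bounded⟩, fun r hr => ?_, fun s => ⟨fun i hi => ?_, fun r hr => ?_⟩⟩
    · rcases hr with hr | hr
      · exact hpv r hr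
      · exact (hq.vars_subset r hr).imp (fun h => by omega) id
    · rw [exec]
      rcases Nat.lt_succ_iff_lt_or_eq.1 hi with h | h
      · rw [hq.exec_of_lt _ _ (by omega), (hps s).1 i h]
      · obtain rfl : i = ⟨l, hl⟩ := Fin.ext h
        rw [hq.exec_self]
        simp only [(hps s).2 _ (hins _)]
    · rw [exec, hq.exec_of_lt _ _ (by omega), (hps s).2 r hr]

/-- The values of the `g i` occupy `k + 1, …, k + n`. Since an output register must lie above its
inputs, `f` writes to `k + 1 + n`, and the result is then moved down to `k`. -/
theorem exists_computes_comp {m n : ℕ} {f : List.Vector ℕ n → ℕ} {g : Fin n → List.Vector ℕ m → ℕ}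
    (hf : ∀ (ins : Fin n → ℕ) l, (∀ j, ins j < l) → ∃ p : LoopProgram, p.Computes f ins l)
    (hg : ∀ i (ins : Fin m → ℕ) l, (∀ j, ins j < l) → ∃ p : LoopProgram, p.Computes (g i) ins l)
    (ins : Fin m → ℕ) (k : ℕ) (hins : ∀ j, ins j < k) :
    ∃ p : LoopProgram, p.Computes (fun v => f (List.Vector.ofFn fun i => g i v)) ins k := by
  obtain ⟨p, hp, hpv, hps⟩ := exists_computes_family (k := k + 1)
    (fun i => (hins i).trans k.lt_succ_self) (fun i => hg i ins) n le_rfl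
  obtain ⟨q, hq⟩ := hf (fun i => k + 1 + i) (k + 1 + n) (fun i => by omega)
  have hne : k + 1 + n ≠ k := by omega
  refine ⟨seq p (seq q (move (k + 1 + n) k)), ⟨hp, hq.bounded, bounded_move hne⟩,
    fun r hr => ?_, fun s => ?_, fun s r hr => ?_⟩
  · rcases hr with hr | hr | hr
    · exact (hpv r hr).imp (fun h => by omega) id
    · rcases hq.vars_subset r hr with h | ⟨i, rfl⟩ <;> left <;> omega
    · rcases mem_vars_move.1 hr with h | h <;> left <;> omega
  · rw [exec, exec, exec_move hne, Function.update_of_ne hne.symm, Function.update_self,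
      hq.exec_self]
    simp only [(hps s).1 _ (Fin.is_lt _)]
  · rw [exec, exec, exec_move hne, Function.update_of_ne (by omega),
      Function.update_of_ne (by omega), hq.exec_of_lt _ _ (by omega), (hps s).2 r (by omega)]

/-- Register layout: `k` holds the accumulated value, `k + 1` the rounds left, `k + 2` the recursion
index, and `k + 3` receives the outputs of `f` and `g`, with their scratch space above. -/
theorem exists_computes_prec {n : ℕ} {f : List.Vector ℕ n → ℕ} {g : List.Vector ℕ (n + 2) → ℕ}
    (hf : ∀ (ins : Fin n → ℕ) l, (∀ j, ins j < l) → ∃ p : LoopProgram, p.Computes f ins l)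
    (hg : ∀ (ins : Fin (n + 2) → ℕ) l, (∀ j, ins j < l) → ∃ p : LoopProgram, p.Computes g ins l)
    (ins : Fin (n + 1) → ℕ) (k : ℕ) (hins : ∀ j, ins j < k) :
    ∃ p : LoopProgram, p.Computes (fun v : List.Vector ℕ (n + 1) =>
      v.head.rec (f v.tail) (fun y IH => g (y ::ᵥ IH ::ᵥ v.tail))) ins k := by
  obtain ⟨p, hp⟩ := hf (fun i => ins i.succ) (k + 3) (fun i => by have := hins i.succ; omega)
  obtain ⟨q, hq⟩ := hg (Fin.cons (k + 2) (Fin.cons k fun i => ins i.succ)) (k + 3) (by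
    refine Fin.cases ?_ (Fin.cases ?_ fun i => ?_)
    · simp
    · simp
    · have := hins i.succ
      simp only [Fin.cons_succ]
      omega)
  have hne : k + 3 ≠ k := by omega
  have h0 := hins 0
  set body := seq q (seq (move (k + 3) k) (add (k + 2) 1)) with hbody
  have hbv : ∀ r ∈ body.vars, r ≠ k + 1 ∧ (k ≤ r ∨ ∃ i, r = ins i) := by
    intro r hr
    rcases hr with hr | hr | hr
    · rcases hq.vars_subset r hr with h | ⟨i, rfl⟩
      · exact ⟨by omega, .inl (by omega)⟩
      · revert i
        refine Fin.cases ?_ (Fin.cases ?_ fun i => ?_)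
        · simp
        · simp
        · intro
          have := hins i.succ
          simp only [Fin.cons_succ]
          exact ⟨by omega, .inr ⟨_, rfl⟩⟩
    · rcases mem_vars_move.1 hr with rfl | rfl
      · exact ⟨by omega, .inl (by omega)⟩
      · exact ⟨by omega, .inl le_rfl⟩
    · obtain rfl : r = k + 2 := hr
      exact ⟨by omega, .inl (by omega)⟩
  have hloop : k + 1 ∉ body.vars := fun h => (hbv _ h).1 rfl
  refine ⟨seq (copy (ins 0) (k + 1) (k + 2)) (seq p (seq (move (k + 3) k) (seq (clear (k + 2))
    (loop (k + 1) body)))), .intro ⟨bounded_copy (by omega) (by omega), hp.bounded,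
    bounded_move hne, bounded_clear _, hloop, hq.bounded, bounded_move hne, trivial⟩
    (fun r hr => ?_) ?_⟩
  · rcases hr with hr | hr | hr | hr | rfl | hr
    · rcases mem_vars_copy.1 hr with rfl | rfl | rfl
      · exact .inr ⟨0, rfl⟩
      · left; omega
      · left; omega
    · rcases hp.vars_subset r hr with h | ⟨i, rfl⟩
      · left; omega
      · exact .inr ⟨_, rfl⟩
    · rcases mem_vars_move.1 hr with h | h <;> left <;> omega
    · rw [mem_vars_clear] at hr
      left; omega
    · left; omega
    · exact (hbv r hr).2
  · intro s
    set v : List.Vector ℕ n := List.Vector.ofFn fun i => s (ins i.succ) with hv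
    set F : ℕ → ℕ := fun y => y.rec (f v) (fun y IH => g (y ::ᵥ IH ::ᵥ v)) with hF
    -- Invariant: index plus remaining rounds is the recursion argument, the accumulator is the
    -- recursive function at the index, and registers below `k` are unchanged.
    have key := exec_loop_induction hloop
      (I := fun t => t (k + 2) + t (k + 1) = s (ins 0) ∧ t k = F (t (k + 2)) ∧
        ∀ r < k, t r = s r)
      (fun t m hm ⟨h1, h2, h3⟩ => by
        rw [hbody, exec, exec, exec, exec_move hne]
        have hqt := hq.exec_self (update t (k + 1) m)
        have hqlt := hq.exec_of_lt (update t (k + 1) m)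
        have hvec : (List.Vector.ofFn fun i => update t (k + 1) m
            ((Fin.cons (k + 2) (Fin.cons k fun i => ins i.succ) : Fin (n + 2) → ℕ) i)) =
            t (k + 2) ::ᵥ t k ::ᵥ v := by
          change _ ::ᵥ _ ::ᵥ List.Vector.ofFn _ = _
          have (i : Fin n) : update t (k + 1) m (ins i.succ) = s (ins i.succ) := by
            have := hins i.succ
            rw [Function.update_of_ne (by omega), h3 _ this]
          simp [this, hv]
        rw [hvec] at hqt
        have hu1 : q.exec (update t (k + 1) m) (k + 1) = m := by
          rw [hqlt _ (by omega), Function.update_self]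
        have hu2 : q.exec (update t (k + 1) m) (k + 2) = t (k + 2) := by
          rw [hqlt _ (by omega), Function.update_of_ne (by omega)]
        have hult : ∀ r < k, q.exec (update t (k + 1) m) r = s r := fun r hr => by
          rw [hqlt _ (by omega), Function.update_of_ne (by omega), h3 r hr]
        simp only [Function.update_apply]
        refine ⟨?_, ?_, fun r hr => ?_⟩
        · simp [hu1, hu2]
          omega
        · simp [hu2, hqt, h2, hF]
        · rw [if_neg (by omega), if_neg (by omega), if_neg (by omega), hult r hr])
      (s := (clear (k + 2)).exec ((move (k + 3) k).exec (p.exec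
        ((copy (ins 0) (k + 1) (k + 2)).exec s)))) (by
        rw [exec_copy (by omega) (by omega) (by omega), exec_move hne, exec_clear]
        set t := update (update s (k + 1) (s (ins 0))) (k + 2) 0 with ht
        have htlt : ∀ r < k, t r = s r := fun r hr => by
          rw [ht, Function.update_of_ne (by omega), Function.update_of_ne (by omega)]
        refine ⟨?_, ?_, fun r hr => ?_⟩
        · rw [Function.update_self, Function.update_of_ne (by omega),
            Function.update_of_ne (by omega), Function.update_of_ne (by omega),
            hp.exec_of_lt _ _ (by omega), ht, Function.update_of_ne (by omega),
            Function.update_self, zero_add]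
        · rw [Function.update_self, Function.update_of_ne (by omega),
            Function.update_of_ne (by omega), Function.update_self, hp.exec_self]
          simp only [htlt _ (hins _)]
          rfl
        · rw [Function.update_of_ne (by omega), Function.update_of_ne (by omega),
            Function.update_of_ne (by omega), hp.exec_of_lt _ _ (by omega), htlt r hr])
    obtain ⟨⟨h1, h2, h3⟩, h4⟩ := key
    rw [h4, add_zero] at h1
    rw [h1] at h2
    exact ⟨h2, h3⟩

/-- Every primitive recursive function is computed by a bounded loop program. -/
theorem exists_computes {n : ℕ} {f : List.Vector ℕ n → ℕ} (hf : Nat.Primrec' f) :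
    ∀ (ins : Fin n → ℕ) (k : ℕ), (∀ i, ins i < k) → ∃ p : LoopProgram, p.Computes f ins k := by
  induction hf with
  | zero =>
    refine fun ins k _ => ⟨clear k, bounded_clear k, fun r hr => .inl (mem_vars_clear.1 hr).ge,
      fun s => ?_, fun s r hr => ?_⟩
    · rw [exec_clear, Function.update_self]
    · rw [exec_clear, Function.update_of_ne hr.ne]
  | succ =>
    intro ins k hins
    have h0 := hins 0
    refine ⟨seq (copy (ins 0) k (k + 1)) (add k 1),
      ⟨bounded_copy (by omega) (by omega), trivial⟩, fun r hr => ?_, fun s => ?_, fun s r hr => ?_⟩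
    · rcases hr with hr | hr
      · rcases mem_vars_copy.1 hr with rfl | rfl | rfl
        exacts [.inr ⟨0, rfl⟩, .inl le_rfl, .inl k.le_succ]
      · exact .inl (Set.mem_singleton_iff.1 hr).ge
    · rw [exec, exec, exec_copy (by omega) (by omega) (by omega), Function.update_self,
        Function.update_of_ne (by omega), Function.update_self]
      rfl
    · rw [exec, exec, exec_copy (by omega) (by omega) (by omega), Function.update_of_ne (by omega),
        Function.update_of_ne (by omega), Function.update_of_ne (by omega)]
  | get i =>
    intro ins k hins
    have h0 := hins i
    refine ⟨copy (ins i) k (k + 1), bounded_copy (by omega) (by omega), fun r hr => ?_,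
      fun s => ?_, fun s r hr => ?_⟩
    · rcases mem_vars_copy.1 hr with rfl | rfl | rfl
      exacts [.inr ⟨i, rfl⟩, .inl le_rfl, .inl k.le_succ]
    · rw [exec_copy (by omega) (by omega) (by omega), Function.update_of_ne (by omega),
        Function.update_self, List.Vector.get_ofFn]
    · rw [exec_copy (by omega) (by omega) (by omega), Function.update_of_ne (by omega),
        Function.update_of_ne (by omega)]
  | comp g _ _ hf hg => exact exists_computes_comp hf hg
  | prec _ _ hf hg => exact exists_computes_prec hf hg

end LoopProgram

/-! ### Termination of iterated partial functions -/

/-- One step of the computation of the partial function `f`. -/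
def StepsTo {α : Type*} (f : α → Option α) (a b : α) : Prop := f a = some b

/-- The iteration of the partial function `f` from `a` reaches a point where `f` is undefined. -/
def Terminates {α : Type*} (f : α → Option α) (a : α) : Prop := Acc (fun b a => StepsTo f a b) a

section Terminates

variable {α β : Type*} {f : α → Option α} {g : β → Option β} {a b : α}

theorem terminates_of_eq_none (h : f a = none) : Terminates f a :=
  ⟨_, fun b hb => by rw [StepsTo, h] at hb; cases hb⟩

theorem StepsTo.terminates_iff (h : StepsTo f a b) : Terminates f a ↔ Terminates f b := by
  refine ⟨fun ha => ha.inv h, fun hb => ⟨_, fun c hc => ?_⟩⟩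
  obtain rfl : b = c := Option.some.inj (h.symm.trans hc)
  exact hb

theorem terminates_iff_of_reaches (h : Relation.ReflTransGen (StepsTo f) a b) :
    Terminates f a ↔ Terminates f b := by
  induction h with
  | refl => rfl
  | tail _ h ih => rw [ih, h.terminates_iff]

/-- A lockstep simulation preserves and reflects termination. -/
theorem terminates_iff_of_simulation {r : α → β → Prop}
    (hsome : ∀ a b a', r a b → f a = some a' → ∃ b', g b = some b' ∧ r a' b')
    (hnone : ∀ a b, r a b → f a = none → g b = none) {a : α} {b : β} (hab : r a b) :
    Terminates f a ↔ Terminates g b := by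
  constructor
  · intro h
    induction h generalizing b with
    | intro a _ ih =>
      cases hfa : f a with
      | none => exact terminates_of_eq_none (hnone _ _ hab hfa)
      | some a' =>
        obtain ⟨b', hgb, hr⟩ := hsome _ _ _ hab hfa
        exact (StepsTo.terminates_iff hgb).2 (ih a' hfa hr)
  · intro h
    induction h generalizing a with
    | intro b _ ih =>
      cases hfa : f a with
      | none => exact terminates_of_eq_none hfa
      | some a' =>
        obtain ⟨b', hgb, hr⟩ := hsome _ _ _ hab hfa
        exact (StepsTo.terminates_iff hfa).2 (ih b' hgb hr)

end Terminates

/-! ### Counter machines -/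

/-- Instructions of a counter machine, with relative jumps. -/
inductive Instr : Type
  /-- Add `m` to register `r`. -/
  | add (r m : ℕ) : Instr
  /-- If register `r` is zero, skip `d` instructions, otherwise decrease it. -/
  | djz (r d : ℕ) : Instr
  /-- Jump back over `d` instructions. -/
  | back (d : ℕ) : Instr

namespace Instr

open Function (update)

/-- The effect of an instruction on the program counter and the registers. -/
def apply : Instr → ℕ × (ℕ → ℕ) → ℕ × (ℕ → ℕ)
  | add r m, (pc, s) => (pc + 1, update s r (s r + m))
  | djz r d, (pc, s) => if s r = 0 then (pc + 1 + d, s) else (pc + 1, update s r (s r - 1))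
  | back d, (pc, s) => (pc - (d + 1), s)

/-- One step of the counter machine with code `C`. -/
def run (C : List Instr) (c : ℕ × (ℕ → ℕ)) : Option (ℕ × (ℕ → ℕ)) :=
  C[c.1]?.map fun i => i.apply c

/-- The block of code `l` occurs in `C` at position `o`. -/
def CodeAt (C : List Instr) (o : ℕ) (l : List Instr) : Prop :=
  ∀ i < l.length, C[o + i]? = l[i]?

theorem CodeAt.append_left {C : List Instr} {o : ℕ} {l l' : List Instr}
    (h : CodeAt C o (l ++ l')) : CodeAt C o l := fun i hi => by
  rw [h i (by rw [List.length_append]; omega), List.getElem?_append_left hi]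

theorem CodeAt.append_right {C : List Instr} {o : ℕ} {l l' : List Instr}
    (h : CodeAt C o (l ++ l')) : CodeAt C (o + l.length) l' := fun i hi => by
  rw [add_assoc, h _ (by rw [List.length_append]; omega), List.getElem?_append_right (by omega),
    Nat.add_sub_cancel_left]

theorem CodeAt.stepsTo {C : List Instr} {o : ℕ} {i : Instr} {l : List Instr}
    (h : CodeAt C o (i :: l)) (s : ℕ → ℕ) : StepsTo (run C) (o, s) (i.apply (o, s)) := by
  have := h 0 (by simp)
  rw [add_zero] at this
  simp [StepsTo, run, this]

end Instr

/-! ### Compilation of loop programs to counter machines -/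

namespace LoopProgram

open Function (update)

/-- The compilation of a loop program. -/
def code : LoopProgram → List Instr
  | skip => []
  | add r m => [.add r m]
  | seq p q => p.code ++ q.code
  | loop r p => [.djz r (p.code.length + 1)] ++ (p.code ++ [.back p.code.length])

/-- Backward jumps never hit the truncation in `pc - (d + 1)`, so they really change the program
counter. A jump from `0` to `0` would yield a fraction equal to `1`, applicable to every number. -/
theorem lt_of_code_getElem?_eq_back {d : ℕ} : ∀ {p : LoopProgram} {i : ℕ},
    p.code[i]? = some (.back d) → d < i
  | skip, i, h => by simp [code] at h
  | add r m, i, h => by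
    rw [code, List.getElem?_singleton] at h
    split at h <;> simp at h
  | seq p q, i, h => by
    rw [code] at h
    rcases lt_or_ge i p.code.length with hi | hi
    · rw [List.getElem?_append_left hi] at h
      exact lt_of_code_getElem?_eq_back h
    · rw [List.getElem?_append_right hi] at h
      exact (lt_of_code_getElem?_eq_back h).trans_le (Nat.sub_le _ _)
  | loop r p, i, h => by
    rw [code] at h
    cases i with
    | zero => simp at h
    | succ i =>
      rw [List.singleton_append, List.getElem?_cons_succ] at h
      rcases lt_or_ge i p.code.length with hi | hi
      · rw [List.getElem?_append_left hi] at h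
        exact (lt_of_code_getElem?_eq_back h).trans i.lt_succ_self
      · rw [List.getElem?_append_right hi, List.getElem?_singleton] at h
        split at h
        · simp only [Option.some.injEq, Instr.back.injEq] at h
          omega
        · simp at h

theorem length_code_loop (r : ℕ) (p : LoopProgram) :
    (loop r p).code.length = p.code.length + 2 := by
  simp [code]

section Loop

variable {C : List Instr} {o r : ℕ} {p : LoopProgram} (h : Instr.CodeAt C o (loop r p).code)
  {s : ℕ → ℕ}
include h

theorem codeAt_body : Instr.CodeAt C (o + 1) p.code :=
  h.append_right.append_left

theorem stepsTo_loop_exit (hs : s r = 0) :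
    StepsTo (Instr.run C) (o, s) (o + (loop r p).code.length, s) := by
  have := h.stepsTo s
  rw [Instr.apply, if_pos hs] at this
  rw [length_code_loop]
  convert this using 2
  omega

theorem stepsTo_loop_enter {n : ℕ} (hs : s r = n + 1) :
    StepsTo (Instr.run C) (o, s) (o + 1, update s r n) := by
  have := h.stepsTo s
  rwa [Instr.apply, if_neg (by omega), hs] at this

theorem stepsTo_loop_back :
    StepsTo (Instr.run C) (o + 1 + p.code.length, s) (o, s) := by
  have := h.append_right.append_right.stepsTo s
  rw [Instr.apply, List.length_singleton] at this
  convert this using 2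
  omega

end Loop

/-- Compiled code computes the effect of the program. -/
theorem reaches_exec {C : List Instr} : ∀ {p : LoopProgram} {o : ℕ}, p.Bounded →
    Instr.CodeAt C o p.code → ∀ s, Relation.ReflTransGen (StepsTo (Instr.run C)) (o, s)
      (o + p.code.length, p.exec s)
  | skip, _, _, _, _ => .refl
  | add _ _, _, _, h, s => .single (h.stepsTo s)
  | seq p q, o, hb, h, s => by
    rw [code, List.length_append, ← add_assoc]
    exact (reaches_exec hb.1 h.append_left s).trans (reaches_exec hb.2 h.append_right _)
  | loop r p, o, hb, h, s => by
    induction hn : s r generalizing s with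
    | zero =>
      rw [exec_loop_of_eq_zero hn]
      exact .single (stepsTo_loop_exit h hn)
    | succ n ih =>
      rw [exec_loop_of_eq_succ hb.1 hn]
      refine .head (stepsTo_loop_enter h hn) ((reaches_exec hb.2 (codeAt_body h) _).trans
        (.head (stepsTo_loop_back h) (ih _ ?_)))
      rw [exec_of_notMem_vars _ hb.1, Function.update_self]

/-- Compiled code of a bounded program is left from any of its configurations. -/
theorem exists_reaches_end {C : List Instr} : ∀ {p : LoopProgram} {o : ℕ}, p.Bounded →
    Instr.CodeAt C o p.code → ∀ i ≤ p.code.length, ∀ s, ∃ s',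
      Relation.ReflTransGen (StepsTo (Instr.run C)) (o + i, s) (o + p.code.length, s')
  | skip, o, _, h, i, hi, s => by
    obtain rfl : i = 0 := Nat.le_zero.1 hi
    exact ⟨s, .refl⟩
  | add r m, o, hb, h, i, hi, s => by
    rcases Nat.le_one_iff_eq_zero_or_eq_one.1 hi with rfl | rfl
    · exact ⟨_, reaches_exec hb h s⟩
    · exact ⟨s, .refl⟩
  | seq p q, o, hb, h, i, hi, s => by
    rw [code, List.length_append] at hi ⊢
    rw [← add_assoc]
    rcases le_total i p.code.length with hip | hip
    · obtain ⟨s', hs'⟩ := exists_reaches_end hb.1 h.append_left i hip s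
      exact ⟨_, hs'.trans (reaches_exec hb.2 h.append_right s')⟩
    · obtain ⟨j, rfl⟩ := Nat.exists_eq_add_of_le hip
      rw [← add_assoc]
      exact exists_reaches_end hb.2 h.append_right j (by omega) s
  | loop r p, o, hb, h, i, hi, s => by
    rcases Nat.eq_zero_or_pos i with rfl | hi0
    · exact ⟨_, reaches_exec hb h s⟩
    obtain ⟨i, rfl⟩ := Nat.exists_eq_add_of_le' hi0
    rw [length_code_loop] at hi
    rcases Nat.lt_or_ge p.code.length i with hip | hip
    · obtain rfl : i = p.code.length + 1 := by omega
      rw [length_code_loop]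
      exact ⟨s, .refl⟩
    -- Starting inside the body: finish the body, jump back, then run the whole loop from its head.
    · obtain ⟨s', hs'⟩ := exists_reaches_end hb.2 (codeAt_body h) i hip s
      rw [add_comm i, ← add_assoc]
      exact ⟨_, (hs'.tail (stepsTo_loop_back h)).trans (reaches_exec hb h s')⟩

section While

/-! The code of `loop r p` is a while loop if `p` mentions `r`. -/

variable {r : ℕ} {p : LoopProgram}

theorem codeAt_zero (C : List Instr) : Instr.CodeAt C 0 C := fun i _ => by rw [zero_add]

theorem terminates_of_length_le {C : List Instr} {pc : ℕ} (h : C.length ≤ pc) (s : ℕ → ℕ) :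
    Terminates (Instr.run C) (pc, s) :=
  terminates_of_eq_none (by simp [Instr.run, h])

theorem terminates_while_of_eq_zero {s : ℕ → ℕ} (hs : s r = 0) :
    Terminates (Instr.run (loop r p).code) (0, s) :=
  (stepsTo_loop_exit (codeAt_zero _) hs).terminates_iff.2
    (terminates_of_length_le (Nat.le_add_left _ _) s)

/-- Only the body is bounded; it may write to `r`. At least one step is recorded, so that
termination gives an induction over passes. -/
theorem transGen_while (hp : p.Bounded) {s : ℕ → ℕ} {n : ℕ} (hs : s r = n + 1) :
    Relation.TransGen (StepsTo (Instr.run (loop r p).code)) (0, s) (0, p.exec (update s r n)) := by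
  have h := codeAt_zero (loop r p).code
  exact .head' (stepsTo_loop_enter h hs)
    ((reaches_exec hp (codeAt_body h) _).tail (stepsTo_loop_back h))

/-- From any position inside the code, the bounded body runs to its end and jumps back to the head;
beyond the code the machine has already stopped. -/
theorem terminates_while_of_forall_zero (hp : p.Bounded)
    (h : ∀ s, Terminates (Instr.run (loop r p).code) (0, s)) (c : ℕ × (ℕ → ℕ)) :
    Terminates (Instr.run (loop r p).code) c := by
  obtain ⟨pc, s⟩ := c
  have hC := codeAt_zero (loop r p).code
  rcases Nat.eq_zero_or_pos pc with rfl | hpc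
  · exact h s
  obtain ⟨i, rfl⟩ := Nat.exists_eq_add_of_le hpc
  rcases Nat.lt_or_ge p.code.length i with hi | hi
  · exact terminates_of_length_le (by rw [length_code_loop]; omega) s
  · obtain ⟨s', hs'⟩ := exists_reaches_end hp (codeAt_body hC) i hi s
    rw [zero_add] at hs'
    refine (terminates_iff_of_reaches hs').2 ?_
    have := stepsTo_loop_back hC (s := s')
    rw [zero_add] at this
    exact this.terminates_iff.2 (h s')

end While

end LoopProgram

/-! ### Simulation of counter machines by Fractran programs -/

namespace Fractran

theorem iter_succ' (P : Program) {n m : ℕ} (h : step P n = some m) (i : ℕ) :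
    iter P n (i + 1) = iter P m i := by
  induction i with
  | zero => exact h
  | succ i ih => rw [iter, ih, iter]

theorem halts_iff_terminates {P : Program} {n : ℕ} : Halts P n ↔ Terminates (step P) n := by
  constructor
  · rintro ⟨i, hi⟩
    induction i generalizing n with
    | zero => cases hi
    | succ i ih =>
      cases hn : step P n with
      | none => exact terminates_of_eq_none hn
      | some m =>
        rw [iter_succ' P hn] at hi
        exact (StepsTo.terminates_iff hn).2 (ih hi)
  · intro h
    induction h with
    | intro n _ ih =>
      cases hn : step P n with
      | none => exact ⟨1, hn⟩
      | some m =>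
        obtain ⟨i, hi⟩ := ih m hn
        exact ⟨i + 1, by rw [iter_succ' P hn, hi]⟩

theorem step_append (P Q : Program) (n : ℕ) : step (P ++ Q) n = (step P n).or (step Q n) := by
  induction P with
  | nil => rfl
  | cons f P ih =>
    rw [List.cons_append, step, step]
    split
    · rfl
    · exact ih

theorem step_eq_none {P : Program} {n : ℕ} (h : ∀ f ∈ P, ¬ (f.2 : ℕ) ∣ n * f.1) :
    step P n = none := by
  induction P with
  | nil => rfl
  | cons f P ih =>
    rw [step, if_neg (h f List.mem_cons_self), ih fun g hg => h g (List.mem_cons_of_mem _ hg)]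

theorem not_dvd_of_step_eq_none {P : Program} {n : ℕ} (h : step P n = none) :
    ∀ f ∈ P, ¬ (f.2 : ℕ) ∣ n * f.1 := by
  induction P with
  | nil => simp
  | cons f P ih =>
    rw [step] at h
    split at h
    · cases h
    · rename_i hf
      exact List.forall_mem_cons.2 ⟨hf, ih h⟩

/-- The prime for the program counter `i`. -/
noncomputable def statePrime (i : ℕ) : ℕ+ :=
  ⟨Nat.nth Nat.Prime (2 * i), (Nat.prime_nth_prime _).pos⟩

/-- The prime for the register `r`. -/
noncomputable def regPrime (r : ℕ) : ℕ+ :=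
  ⟨Nat.nth Nat.Prime (2 * r + 1), (Nat.prime_nth_prime _).pos⟩

theorem prime_statePrime (i : ℕ) : (statePrime i : ℕ).Prime := Nat.prime_nth_prime _

theorem prime_regPrime (r : ℕ) : (regPrime r : ℕ).Prime := Nat.prime_nth_prime _

theorem nth_prime_inj {i j : ℕ} : Nat.nth Nat.Prime i = Nat.nth Nat.Prime j ↔ i = j :=
  (Nat.nth_injective Nat.infinite_setOfPred_prime).eq_iff

theorem factorization_statePrime_statePrime (i j : ℕ) :
    (statePrime i : ℕ).factorization (statePrime j) = if j = i then 1 else 0 := by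
  rw [(prime_statePrime i).factorization, Finsupp.single_apply]
  refine if_congr ?_ rfl rfl
  rw [statePrime, statePrime, PNat.mk_coe, PNat.mk_coe, nth_prime_inj]
  omega

theorem factorization_statePrime_regPrime (i r : ℕ) :
    (statePrime i : ℕ).factorization (regPrime r) = 0 := by
  rw [(prime_statePrime i).factorization, Finsupp.single_apply, if_neg]
  rw [statePrime, regPrime, PNat.mk_coe, PNat.mk_coe, nth_prime_inj]
  omega

theorem factorization_regPrime_statePrime (i r : ℕ) :
    (regPrime r : ℕ).factorization (statePrime i) = 0 := by
  rw [(prime_regPrime r).factorization, Finsupp.single_apply, if_neg]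
  rw [statePrime, regPrime, PNat.mk_coe, PNat.mk_coe, nth_prime_inj]
  omega

theorem factorization_regPrime_regPrime (r t : ℕ) :
    (regPrime r : ℕ).factorization (regPrime t) = if t = r then 1 else 0 := by
  rw [(prime_regPrime r).factorization, Finsupp.single_apply]
  refine if_congr ?_ rfl rfl
  rw [regPrime, regPrime, PNat.mk_coe, PNat.mk_coe, nth_prime_inj]
  omega

/-- The fractions which simulate an instruction at position `pc`. -/
noncomputable def rules (pc : ℕ) : Instr → Program
  | .add r m => [(regPrime r ^ m * statePrime (pc + 1), statePrime pc)]
  | .djz r d => [(statePrime (pc + 1), statePrime pc * regPrime r),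
      (statePrime (pc + 1 + d), statePrime pc)]
  | .back d => [(statePrime (pc - (d + 1)), statePrime pc)]

/-- The fractions which simulate a block of code at position `o`. -/
noncomputable def codeRules : ℕ → List Instr → Program
  | _, [] => []
  | o, i :: l => rules o i ++ codeRules (o + 1) l

theorem codeRules_append (o : ℕ) (l l' : List Instr) :
    codeRules o (l ++ l') = codeRules o l ++ codeRules (o + l.length) l' := by
  induction l generalizing o with
  | nil => rfl
  | cons i l ih =>
    rw [List.cons_append, codeRules, codeRules, ih, List.append_assoc, List.length_cons,
      add_right_comm, ← add_assoc]

/-- Fractions which remove pairs of program counters. -/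
noncomputable def cleanup (L : ℕ) : Program :=
  (List.range L ×ˢ List.range L).map fun p => (1, statePrime p.1 * statePrime p.2)

/-- The Fractran program simulating the counter machine with code `C`. -/
noncomputable def ofCode (C : List Instr) : Program :=
  cleanup C.length ++ codeRules 0 C

/-- The number `n` represents the configuration `c` of a counter machine with `L` instructions. -/
structure Represents (L n : ℕ) (c : ℕ × (ℕ → ℕ)) : Prop where
  pos : 0 < n
  state : ∀ j < L, n.factorization (statePrime j) = if j = c.1 then 1 else 0
  reg : ∀ r, n.factorization (regPrime r) = c.2 r

theorem factorization_coe_mul (a b : ℕ+) (q : ℕ) : ((a * b : ℕ+) : ℕ).factorization q =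
    (a : ℕ).factorization q + (b : ℕ).factorization q := by
  rw [PNat.mul_coe, Nat.factorization_mul a.ne_zero b.ne_zero, Finsupp.add_apply]

theorem factorization_coe_pow (a : ℕ+) (m q : ℕ) : ((a ^ m : ℕ+) : ℕ).factorization q =
    m * (a : ℕ).factorization q := by
  rw [PNat.pow_coe, Nat.factorization_pow, Finsupp.smul_apply, smul_eq_mul]

theorem div_pos_of_dvd {n : ℕ} {a b : ℕ+} (hn : 0 < n) (h : (b : ℕ) ∣ n * a) :
    0 < n * a / (b : ℕ) :=
  Nat.div_pos (Nat.le_of_dvd (Nat.mul_pos hn a.pos) h) b.pos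

theorem factorization_mul_div {n : ℕ} {a b : ℕ+} (hn : 0 < n) (h : (b : ℕ) ∣ n * a) (q : ℕ) :
    (n * a / (b : ℕ)).factorization q + (b : ℕ).factorization q =
      n.factorization q + (a : ℕ).factorization q := by
  rw [← Finsupp.add_apply, ← Nat.factorization_mul (div_pos_of_dvd hn h).ne' b.ne_zero,
    Nat.div_mul_cancel h, Nat.factorization_mul hn.ne' a.ne_zero, Finsupp.add_apply]

theorem factorization_le_of_dvd {n : ℕ} {a b : ℕ+} (hn : 0 < n) (h : (b : ℕ) ∣ n * a) (q : ℕ) :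
    (b : ℕ).factorization q ≤ n.factorization q + (a : ℕ).factorization q :=
  (Nat.le_add_left _ _).trans_eq (factorization_mul_div hn h q)

theorem mem_cleanup {L : ℕ} {f : Fraction} : f ∈ cleanup L ↔
    ∃ i < L, ∃ j < L, f = (1, statePrime i * statePrime j) := by
  simp only [cleanup, List.mem_map, List.mem_product, List.mem_range, Prod.exists]
  constructor
  · rintro ⟨i, j, ⟨hi, hj⟩, rfl⟩
    exact ⟨i, hi, j, hj, rfl⟩
  · rintro ⟨i, hi, j, hj, rfl⟩
    exact ⟨i, j, ⟨hi, hj⟩, rfl⟩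

theorem Represents.statePrime_not_dvd {L n : ℕ} {c : ℕ × (ℕ → ℕ)} (h : Represents L n c) {j : ℕ}
    (hj : j < L) (hjc : j ≠ c.1) : ¬ (statePrime j : ℕ) ∣ n := by
  rw [(prime_statePrime j).dvd_iff_one_le_factorization h.pos.ne', h.state j hj, if_neg hjc]
  exact Nat.not_succ_le_zero 0

theorem Represents.statePrime_dvd {L n : ℕ} {c : ℕ × (ℕ → ℕ)} (h : Represents L n c)
    (hc : c.1 < L) : (statePrime c.1 : ℕ) ∣ n := by
  rw [(prime_statePrime c.1).dvd_iff_one_le_factorization h.pos.ne', h.state _ hc, if_pos rfl]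

theorem Represents.step_cleanup {L n : ℕ} {c : ℕ × (ℕ → ℕ)} (h : Represents L n c) :
    step (cleanup L) n = none := by
  refine step_eq_none fun f hf hdvd => ?_
  obtain ⟨i, hi, j, hj, rfl⟩ := mem_cleanup.1 hf
  have h1 := factorization_le_of_dvd h.pos hdvd (statePrime i)
  have h2 := factorization_le_of_dvd h.pos hdvd (statePrime j)
  simp only [factorization_coe_mul, factorization_statePrime_statePrime, h.state i hi,
    h.state j hj, PNat.one_coe, Nat.factorization_one, Finsupp.coe_zero, Pi.zero_apply] at h1 h2
  split_ifs at h1 h2 <;> omega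

/-- Because the state prime divides the denominator but not the numerator, a rule for `pc` can fire
only on multiples of that prime, even though the fractions need not be reduced. -/
theorem of_mem_rules {pc : ℕ} {i : Instr} (hi : ∀ d, i = .back d → d < pc) {f : Fraction}
    (hf : f ∈ rules pc i) : (statePrime pc : ℕ) ∣ f.2 ∧ ¬ (statePrime pc : ℕ) ∣ f.1 := by
  rw [(prime_statePrime pc).dvd_iff_one_le_factorization f.1.ne_zero]
  cases i with
  | add r m =>
    obtain rfl := List.mem_singleton.1 hf
    simp [factorization_regPrime_statePrime, factorization_statePrime_statePrime]
  | djz r d =>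
    simp only [rules, List.mem_cons, List.not_mem_nil, or_false] at hf
    rcases hf with rfl | rfl
    · simp [factorization_statePrime_statePrime]
    · simp [factorization_statePrime_statePrime]
      omega
  | back d =>
    obtain rfl := List.mem_singleton.1 hf
    have := hi d rfl
    simp [factorization_statePrime_statePrime]
    omega

theorem step_rules_eq_none {pc : ℕ} {i : Instr} (hi : ∀ d, i = .back d → d < pc) {n : ℕ}
    (hn : ¬ (statePrime pc : ℕ) ∣ n) : step (rules pc i) n = none :=
  step_eq_none fun _ hf hdvd =>
    have h := of_mem_rules hi hf
    ((prime_statePrime pc).dvd_mul.1 (h.1.trans hdvd)).elim hn h.2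

/-- When no state prime of the block other than that of position `k` divides `n`, the rules of every
other position are blocked, so the order of the positions is irrelevant. -/
theorem step_codeRules {n : ℕ} : ∀ {l : List Instr} {o : ℕ} (k : ℕ),
    (∀ i d, l[i]? = some (.back d) → d < o + i) →
    (∀ j < l.length, j ≠ k → ¬ (statePrime (o + j) : ℕ) ∣ n) →
    step (codeRules o l) n = l[k]?.bind fun i => step (rules (o + k) i) n
  | [], _, _, _, _ => by simp [codeRules, step]
  | i :: l, o, k, hb, hn => by
    have hi : ∀ d, i = .back d → d < o := fun d hd => hb 0 d (by simp [hd])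
    have hb' : ∀ i d, l[i]? = some (.back d) → d < o + 1 + i := fun i d h => by
      have := hb (i + 1) d (by simpa using h)
      omega
    have hn' (j : ℕ) (hj : j < l.length) (hjk : j + 1 ≠ k) :
        ¬ (statePrime (o + 1 + j) : ℕ) ∣ n := by
      rw [add_assoc, add_comm 1 j]
      exact hn (j + 1) (by simpa using hj) hjk
    rw [codeRules, step_append]
    cases k with
    | zero =>
      -- The index `l.length` is out of range, so the tail contributes `none`.
      rw [step_codeRules l.length hb' fun j hj _ => hn' j hj j.succ_ne_zero]
      simp
    | succ k =>
      rw [step_rules_eq_none hi (hn 0 (by simp) k.succ_ne_zero.symm),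
        step_codeRules k hb' fun j hj hjk => hn' j hj (by omega)]
      simp [add_assoc, add_comm 1 k]

section Simulation

variable {C : List Instr} (hC : ∀ i d : ℕ, C[i]? = some (Instr.back d) → d < i)
include hC

theorem Represents.step_ofCode {n : ℕ} {c : ℕ × (ℕ → ℕ)} (h : Represents C.length n c) :
    step (ofCode C) n = C[c.1]?.bind fun i => step (rules c.1 i) n := by
  rw [ofCode, step_append, h.step_cleanup, Option.none_or,
    step_codeRules c.1 (by simpa using hC)
      (fun j hj hjc => by rw [zero_add]; exact h.statePrime_not_dvd hj hjc), zero_add]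

/-- Multiplication by a fraction is addition and subtraction of prime exponents
(`factorization_mul_div`), checked separately at state primes and register primes. -/
theorem Represents.exists_step {n : ℕ} {c : ℕ × (ℕ → ℕ)} (h : Represents C.length n c)
    {i : Instr} (hi : C[c.1]? = some i) :
    ∃ n', step (ofCode C) n = some n' ∧ Represents C.length n' (i.apply c) := by
  rw [h.step_ofCode hC, hi, Option.bind_some]
  obtain ⟨pc, s⟩ := c
  have hpc : pc < C.length := (List.getElem?_eq_some_iff.1 hi).1
  have hdvd : (statePrime pc : ℕ) ∣ n := h.statePrime_dvd hpc
  have hst := h.state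
  have hreg := h.reg
  dsimp only at hst hreg
  cases i with
  | add r m =>
    have hd := hdvd.mul_right ((regPrime r ^ m * statePrime (pc + 1) : ℕ+) : ℕ)
    refine ⟨_, by rw [rules, step, if_pos hd], div_pos_of_dvd h.pos hd, fun j hj => ?_,
      fun t => ?_⟩
    · have := factorization_mul_div h.pos hd (statePrime j)
      simp only [factorization_coe_mul, factorization_coe_pow, factorization_regPrime_statePrime,
        factorization_statePrime_statePrime, hst j hj] at this
      change _ = if j = pc + 1 then 1 else 0
      omega
    · have := factorization_mul_div h.pos hd (regPrime t)
      simp only [factorization_coe_mul, factorization_coe_pow, factorization_regPrime_regPrime,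
        factorization_statePrime_regPrime, hreg] at this
      simp only [Instr.apply, Function.update_apply]
      split_ifs at this ⊢ with htr
      · subst htr; omega
      · omega
  | djz r d =>
    by_cases hr : s r = 0
    · have hd := hdvd.mul_right (statePrime (pc + 1 + d) : ℕ)
      -- The decrement rule is listed first; with register `r` empty it is blocked, since `regPrime
      -- r` divides neither `n` nor the numerator, and the zero branch fires.
      have hd' : ¬ ((statePrime pc * regPrime r : ℕ+) : ℕ) ∣ n * statePrime (pc + 1) := by
        intro hd'
        have := factorization_le_of_dvd h.pos hd' (regPrime r)
        simp only [factorization_coe_mul, factorization_statePrime_regPrime,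
          factorization_regPrime_regPrime, hreg, hr, if_true] at this
        omega
      rw [Instr.apply, if_pos hr]
      refine ⟨_, by rw [rules, step, if_neg hd', step, if_pos hd], div_pos_of_dvd h.pos hd,
        fun j hj => ?_, fun t => ?_⟩
      · have := factorization_mul_div h.pos hd (statePrime j)
        simp only [factorization_statePrime_statePrime, hst j hj] at this
        dsimp only
        omega
      · have := factorization_mul_div h.pos hd (regPrime t)
        simp only [factorization_statePrime_regPrime, hreg] at this
        exact this
    · have hrd : (regPrime r : ℕ) ∣ n := by
        rw [(prime_regPrime r).dvd_iff_one_le_factorization h.pos.ne', hreg]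
        omega
      have hcop : Nat.Coprime (statePrime pc) (regPrime r) := by
        refine (Nat.coprime_primes (prime_statePrime pc) (prime_regPrime r)).2 fun he => ?_
        have := factorization_statePrime_statePrime pc pc
        nth_rewrite 1 [he] at this
        rw [if_pos rfl, factorization_regPrime_statePrime] at this
        exact zero_ne_one this
      have hd : ((statePrime pc * regPrime r : ℕ+) : ℕ) ∣ n * statePrime (pc + 1) :=
        (hcop.mul_dvd_of_dvd_of_dvd hdvd hrd).mul_right _
      rw [Instr.apply, if_neg hr]
      refine ⟨_, by rw [rules, step, if_pos hd], div_pos_of_dvd h.pos hd,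
        fun j hj => ?_, fun t => ?_⟩
      · have := factorization_mul_div h.pos hd (statePrime j)
        simp only [factorization_coe_mul, factorization_statePrime_statePrime,
          factorization_regPrime_statePrime, hst j hj] at this
        dsimp only
        omega
      · have := factorization_mul_div h.pos hd (regPrime t)
        simp only [factorization_coe_mul, factorization_statePrime_regPrime,
          factorization_regPrime_regPrime, hreg] at this
        simp only [Function.update_apply]
        split_ifs at this ⊢ with htr
        · subst htr; omega
        · omega
  | back d =>
    have hd := hdvd.mul_right (statePrime (pc - (d + 1)) : ℕ)
    refine ⟨_, by rw [rules, step, if_pos hd], div_pos_of_dvd h.pos hd, fun j hj => ?_,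
      fun t => ?_⟩
    · have := factorization_mul_div h.pos hd (statePrime j)
      simp only [factorization_statePrime_statePrime, hst j hj] at this
      change _ = if j = pc - (d + 1) then 1 else 0
      omega
    · have := factorization_mul_div h.pos hd (regPrime t)
      simp only [factorization_statePrime_regPrime, hreg] at this
      exact this

theorem Represents.terminates_iff {n : ℕ} {c : ℕ × (ℕ → ℕ)} (h : Represents C.length n c) :
    Terminates (Instr.run C) c ↔ Terminates (step (ofCode C)) n := by
  refine terminates_iff_of_simulation (r := fun c n => Represents C.length n c)
    (fun c n c' hr hc => ?_) (fun c n hr hc => ?_) h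
  · obtain ⟨i, hi, rfl⟩ := Option.map_eq_some_iff.1 hc
    exact hr.exists_step hC hi
  · rw [hr.step_ofCode hC, Option.map_eq_none_iff.1 hc, Option.bind_none]

-- When no cleanup fraction applies, at most one state prime below `L` divides `n`, and only to the
-- first power. If there is one, it is the program counter; if there is none, the counter `L` stands
-- for a halted machine.
omit hC in
theorem exists_represents {L n : ℕ} (hn : 0 < n) (h : step (cleanup L) n = none) :
    ∃ c, Represents L n c := by
  have hnd : ∀ i < L, ∀ j < L, ¬ (statePrime i * statePrime j : ℕ) ∣ n := fun i hi j hj hd =>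
    not_dvd_of_step_eq_none h _ (mem_cleanup.2 ⟨i, hi, j, hj, rfl⟩) (by simpa using hd)
  have hle : ∀ j < L, n.factorization (statePrime j) ≤ 1 := fun j hj => by
    by_contra hlt
    refine hnd j hj j hj ?_
    rw [← pow_two, (prime_statePrime j).pow_dvd_iff_le_factorization hn.ne']
    omega
  by_cases hex : ∃ i < L, 1 ≤ n.factorization (statePrime i)
  · obtain ⟨i, hi, hni⟩ := hex
    refine ⟨(i, fun r => n.factorization (regPrime r)), hn, fun j hj => ?_, fun _ => rfl⟩
    by_cases hji : j = i
    · subst hji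
      rw [if_pos rfl]
      exact le_antisymm (hle j hj) hni
    · rw [if_neg hji]
      by_contra hnj
      refine hnd i hi j hj (Nat.Coprime.mul_dvd_of_dvd_of_dvd ?_ ?_ ?_)
      · refine (Nat.coprime_primes (prime_statePrime i) (prime_statePrime j)).2 fun he => hji ?_
        have := factorization_statePrime_statePrime i j
        rw [he, (prime_statePrime j).factorization_self] at this
        by_contra hne
        rw [if_neg hne] at this
        exact one_ne_zero this
      · exact ((prime_statePrime i).dvd_iff_one_le_factorization hn.ne').2 hni
      · exact ((prime_statePrime j).dvd_iff_one_le_factorization hn.ne').2 (by omega)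
  · push Not at hex
    refine ⟨(L, fun r => n.factorization (regPrime r)), hn, fun j hj => ?_, fun _ => rfl⟩
    have := hex j hj
    rw [if_neg hj.ne]
    omega

-- Cleanup fractions have numerator `1` and denominator greater than `1`, so there is no infinite
-- run of cleanup steps.
omit hC in
theorem lt_of_step_cleanup {L n m : ℕ} (hn : 0 < n) (h : step (cleanup L) n = some m) :
    0 < m ∧ m < n := by
  have hmem : ∀ f ∈ cleanup L, f.1 = 1 ∧ 1 < (f.2 : ℕ) := fun f hf => by
    obtain ⟨i, _, j, _, rfl⟩ := mem_cleanup.1 hf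
    exact ⟨rfl, Nat.one_lt_mul_iff.2 ⟨(statePrime i).pos, (statePrime j).pos,
      .inl (prime_statePrime i).one_lt⟩⟩
  generalize cleanup L = P at h hmem
  induction P with
  | nil => cases h
  | cons f P ih =>
    rw [step] at h
    split at h
    · rename_i hd
      obtain ⟨h1, h2⟩ := hmem f List.mem_cons_self
      obtain rfl := Option.some.inj h
      refine ⟨div_pos_of_dvd hn hd, ?_⟩
      rw [h1, PNat.one_coe, mul_one]
      exact Nat.div_lt_self hn h2
    · exact ih h fun g hg => hmem g (List.mem_cons_of_mem _ hg)

/-- If the counter machine terminates on all configurations, then its simulation halts on all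
positive integers. -/
theorem uniformlyHalts_ofCode (h : ∀ c, Terminates (Instr.run C) c) :
    UniformlyHalts (ofCode C) := by
  intro n hn
  rw [halts_iff_terminates]
  -- The induction handles cleanup steps; once none applies, `n` represents a configuration and the
  -- simulation takes over.
  induction n using Nat.strong_induction_on with
  | _ n ih =>
    cases hs : step (cleanup C.length) n with
    | none =>
      obtain ⟨c, hc⟩ := exists_represents hn hs
      exact (hc.terminates_iff hC).1 (h c)
    | some m =>
      obtain ⟨hm, hmn⟩ := lt_of_step_cleanup hn hs
      have : StepsTo (step (ofCode C)) n m := by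
        rw [StepsTo, ofCode, step_append, hs, Option.some_or]
      exact this.terminates_iff.2 (ih m hmn hm)

end Simulation

/-- Changing `a` alters a single numerator. All primes enter as fixed constants, so the
noncomputable choice of primes does not matter. -/
theorem primrec_ofCode (l l' : List Instr) (r : ℕ) :
    Primrec fun a => ofCode (l ++ .add r a :: l') := by
  have hpow : Primrec fun a : ℕ => regPrime r ^ a * statePrime (l.length + 1) := by
    -- The numerator is computed in `ℕ`, then carried to `ℕ+` by predecessor followed by `succPNat`,
    -- which is harmless as it is positive.
    refine (Primrec.succPNat.comp (Primrec.pred.comp (Primrec.nat_mul.comp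
      (Primrec.nat_pow_left (regPrime r)) (Primrec.const (statePrime (l.length + 1) : ℕ))))).of_eq
      fun a => PNat.coe_injective ?_
    rw [Nat.succPNat_coe, Nat.succ_eq_add_one, Nat.pred_eq_sub_one, Nat.sub_add_cancel]
    · simp
    · exact (regPrime r ^ a * statePrime (l.length + 1) : ℕ+).pos
  refine (Primrec.list_append.comp
    (Primrec.const (cleanup (l.length + (l'.length + 1)) ++ codeRules 0 l))
    (Primrec.list_cons.comp (hpow.pair (Primrec.const (statePrime l.length)))
      (Primrec.const (codeRules (l.length + 1) l')))).of_eq fun a => ?_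
  simp [ofCode, codeRules_append, codeRules, rules]

end Fractran

/-! ### The search machine -/

namespace LoopProgram

open Function (update)

/-- The body of the search loop: put `a` in register `0`, increase the bound in register `2`, and
run the test `F`. -/
def searchBody (F : LoopProgram) (a : ℕ) : LoopProgram :=
  seq (clear 0) (seq (add 0 a) (seq (add 2 1) F))

theorem exists_code_loop_searchBody (F : LoopProgram) (r : ℕ) :
    ∃ l l', ∀ a, (loop r (searchBody F a)).code = l ++ .add 0 a :: l' :=
  -- The body has `F.code.length + 4` instructions: two for `clear 0`, two additions and `F`.
  ⟨[.djz r (F.code.length + 5), .djz 0 1, .back 0],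
    .add 2 1 :: F.code ++ [.back (F.code.length + 4)], fun a => by
      simp [searchBody, code, clear]⟩

section Search

variable {F : LoopProgram} {f : List.Vector ℕ 3 → ℕ} (hF : F.Computes f (fun i => (i : ℕ)) 3)
include hF

theorem bounded_searchBody (a : ℕ) : (searchBody F a).Bounded :=
  ⟨bounded_clear 0, trivial, trivial, hF.bounded⟩

/-- This holds for arbitrary `s`: register `0` is rewritten on each pass, and `F` tolerates garbage
in its scratch registers. Register `1` holds `x`, and `3` is both the output of `F` and the loop
control. -/
theorem exec_searchBody (a : ℕ) (s : ℕ → ℕ) :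
    (searchBody F a).exec s 1 = s 1 ∧ (searchBody F a).exec s 2 = s 2 + 1 ∧
      (searchBody F a).exec s 3 = f (a ::ᵥ s 1 ::ᵥ (s 2 + 1) ::ᵥ .nil) := by
  simp only [searchBody, exec, exec_clear]
  refine ⟨?_, ?_, ?_⟩
  · rw [hF.exec_of_lt _ _ (by omega)]
    simp
  · rw [hF.exec_of_lt _ _ (by omega)]
    simp
  · rw [hF.exec_self]
    congr 1
    simp [List.Vector.ofFn]

/-- Each pass tests the next bound and leaves the value of `f` in register `3`, so the loop ends at
the first zero of `f` beyond the initial bound. -/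
theorem terminates_search_iff (a : ℕ) {s : ℕ → ℕ} (hs : s 3 ≠ 0) :
    Terminates (Instr.run (loop 3 (searchBody F a)).code) (0, s) ↔
      ∃ t, s 2 < t ∧ f (a ::ᵥ s 1 ::ᵥ t ::ᵥ .nil) = 0 := by
  have step {s : ℕ → ℕ} (hs : s 3 ≠ 0) := transGen_while (bounded_searchBody hF a)
    (Nat.succ_pred_eq_of_ne_zero hs).symm
  have val (s : ℕ → ℕ) (n : ℕ) := exec_searchBody hF a (update s 3 n)
  simp only [Function.update_of_ne (by decide : (1 : ℕ) ≠ 3),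
    Function.update_of_ne (by decide : (2 : ℕ) ≠ 3)] at val
  constructor
  · intro h
    -- One pass takes many machine steps, so the induction runs along the transitive closure.
    replace h := h.transGen
    generalize hc : ((0, s) : ℕ × (ℕ → ℕ)) = c at h
    induction h generalizing s with
    | intro c _ ih =>
      subst hc
      obtain ⟨h1, h2, h3⟩ := val s (s 3).pred
      by_cases h0 : f (a ::ᵥ s 1 ::ᵥ (s 2 + 1) ::ᵥ .nil) = 0
      · exact ⟨_, Nat.lt_succ_self _, h0⟩
      · obtain ⟨t, ht, hft⟩ := ih _ (step hs).swap (by rwa [h3]) rfl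
        rw [h1] at hft
        exact ⟨t, by omega, hft⟩
  · rintro ⟨t, ht, hft⟩
    obtain ⟨d, rfl⟩ := Nat.exists_eq_add_of_lt ht
    induction d generalizing s with
    | zero =>
      refine (terminates_iff_of_reaches (step hs).to_reflTransGen).2
        (terminates_while_of_eq_zero ?_)
      rw [(val s _).2.2]
      exact hft
    | succ d ih =>
      refine (terminates_iff_of_reaches (step hs).to_reflTransGen).2 ?_
      obtain ⟨h1, h2, h3⟩ := val s (s 3).pred
      by_cases h0 : f (a ::ᵥ s 1 ::ᵥ (s 2 + 1) ::ᵥ .nil) = 0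
      -- The search may succeed before reaching the given witness.
      · exact terminates_while_of_eq_zero (h3.trans h0)
      · refine ih (by rwa [h3]) (by omega) ?_
        rw [h1, h2, add_assoc (s 2), add_comm 1 d]
        exact hft

/-- The initial bound may already exceed a given witness; persistence of the zero supplies a witness
above it. -/
theorem forall_terminates_search (a : ℕ)
    (hmono : ∀ x t t', t ≤ t' → f (a ::ᵥ x ::ᵥ t ::ᵥ .nil) = 0 →
      f (a ::ᵥ x ::ᵥ t' ::ᵥ .nil) = 0) (h : ∀ x, ∃ t, f (a ::ᵥ x ::ᵥ t ::ᵥ .nil) = 0)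
    (c : ℕ × (ℕ → ℕ)) : Terminates (Instr.run (loop 3 (searchBody F a)).code) c := by
  refine terminates_while_of_forall_zero (bounded_searchBody hF a) (fun s => ?_) c
  by_cases hs : s 3 = 0
  · exact terminates_while_of_eq_zero hs
  · obtain ⟨t, ht⟩ := h (s 1)
    exact (terminates_search_iff hF a hs).2
      ⟨max t (s 2 + 1), Nat.lt_of_succ_le (le_max_right _ _), hmono _ _ _ (le_max_left _ _) ht⟩

end Search

end LoopProgram

/-! ### The reduction -/

namespace Fractran

/-- Initial configuration for input `x`: register `3` is `1` so that the loop is entered, and the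
bound in register `2` is `0`. -/
theorem represents_search_start (L x : ℕ) :
    Represents L (statePrime 0 * (regPrime 3 * regPrime 1 ^ x) : ℕ+)
      (0, fun r => if r = 3 then 1 else if r = 1 then x else 0) := by
  refine ⟨PNat.pos _, fun j _ => ?_, fun r => ?_⟩
  · simp only [factorization_coe_mul, factorization_coe_pow, factorization_statePrime_statePrime,
      factorization_regPrime_statePrime, mul_zero, add_zero]
  · simp only [factorization_coe_mul, factorization_coe_pow, factorization_statePrime_regPrime,
      factorization_regPrime_regPrime]
    split_ifs <;> omega

theorem isPi02Hard_uniformlyHalts : IsPi02Hard UniformlyHalts := by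
  intro q hq
  obtain ⟨f, hf, hmono, hqf⟩ := hq.exists_primrec'
  obtain ⟨F, hF⟩ := LoopProgram.exists_computes hf (fun i => (i : ℕ)) 3 fun i => i.is_lt
  obtain ⟨l, l', hl⟩ := LoopProgram.exists_code_loop_searchBody F 3
  refine ⟨fun a => ofCode (LoopProgram.loop 3 (F.searchBody a)).code, ?_, fun a => ?_⟩
  · simp only [hl]
    exact (primrec_ofCode l l' 0).to_comp
  · have hback := fun i d => LoopProgram.lt_of_code_getElem?_eq_back (d := d)
      (p := LoopProgram.loop 3 (F.searchBody a)) (i := i)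
    rw [hqf]
    constructor
    · exact fun h => uniformlyHalts_ofCode hback
        (LoopProgram.forall_terminates_search hF a (hmono a) h)
    · intro h x
      -- Only positivity is used here, so the length `0` is an arbitrary choice.
      have hx := h _ (represents_search_start 0 x).pos
      rw [halts_iff_terminates, ← (represents_search_start _ x).terminates_iff hback,
        LoopProgram.terminates_search_iff hF a one_ne_zero] at hx
      obtain ⟨t, -, ht⟩ := hx
      exact ⟨t, ht⟩

end Fractran

theorem theorem1 : IsPi02Complete Fractran.UniformlyHalts :=
  ⟨Fractran.isPi02_uniformlyHalts, Fractran.isPi02Hard_uniformlyHalts⟩
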